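/- Let $G=(V,E)$ be a finite connected graph, possibly with loops and multiple edges. Identify each edge with the interval $[0,1]$, its ends being glued to the corresponding vertices. This makes $G$ a topological space, in which a set is closed iff its intersection with each edge is closed, and a measure space $(G,\mu_G)$, in which each edge carries the Lebesgue measure of $[0,1]$. For $r\in\mathbb{R}$ let $X_r(G)$ be the set of nonempty closed connected subsets $U\subseteq G$ with $\mu_G(U)=r$. The partition set $P(G)$ is the set of real numbers $r$ for which there exist integers $n,k\ge 1$ and a finite family $U_1,\dots,U_k\in X_r(G)$ (repetitions allowed) such that all but finitely many points of $G$ lie in exactly $n$ members of the family. The chord set $H(G)$ is the set of real numbers $r$ such that for every function $f:G\to\mathbb{R}$ whose restriction to each edge is Riemann integrable and which satisfies $\int_G f\,d\mu_G=0$ there exists $U\in X_r(G)$ with $\int_U f\,d\mu_G=0$. Then $\overline{P(G)}\subseteq H(G)$, where $\overline{P(G)}$ is the closure of $P(G)$ in $\mathbb{R}$. -/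

import Mathlib

open MeasureTheory
open scoped unitInterval Graph

namespace MetricGraph

/-- A multigraph (loops and multiple edges allowed) is connected if it has a vertex and any two of
its vertices are joined by a finite chain of adjacent vertices. -/
def IsConnectedGraph {α β : Type*} (G : Graph α β) : Prop :=
  V(G).Nonempty ∧ ∀ x ∈ V(G), ∀ y ∈ V(G), Relation.ReflTransGen G.Adj x y

/-- An identification of each edge of `G` with the interval `[0,1]`: it is determined by saying
which end of the edge corresponds to `0` and which to `1`. (For a loop both ends agree.) -/
structure EdgeParam {α β : Type*} (G : Graph α β) where
  /-- the end of the edge at parameter `0` -/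
  src : E(G) → V(G)
  /-- the end of the edge at parameter `1` -/
  tgt : E(G) → V(G)
  isLink : ∀ e : E(G), G.IsLink (e : β) (src e : α) (tgt e : α)

/-- The points of the graph `G`: its vertices, and the points in the interior of its edges, the
latter being `(e, t)` with `e` an edge and `0 < t < 1`. -/
inductive Point {α β : Type*} {G : Graph α β} (O : EdgeParam G) : Type _
  | vertex (v : V(G)) : Point O
  | interior (e : E(G)) (t : Set.Ioo (0 : ℝ) 1) : Point O

section

variable {α β : Type*} {G : Graph α β} (O : EdgeParam G)

open Classical in
/-- The characteristic map `[0,1] → G` of the edge `e`, which runs through `e` from its end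
`O.src e` to its end `O.tgt e`. -/
noncomputable def edge (e : E(G)) (t : I) : Point O :=
  if h : (t : ℝ) ∈ Set.Ioo (0 : ℝ) 1 then Point.interior e ⟨t, h⟩
  else if (t : ℝ) = 0 then Point.vertex (O.src e)
  else Point.vertex (O.tgt e)

/-- The topology of the graph: a set is closed (open) iff its trace on each edge, identified with
`[0,1]`, is closed (open). -/
noncomputable instance : TopologicalSpace (Point O) :=
  ⨆ e : E(G), TopologicalSpace.coinduced (edge O e) inferInstance

/-- The σ-algebra of the graph: a set is measurable iff its trace on each edge, identified with
`[0,1]`, is Borel. -/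
noncomputable instance : MeasurableSpace (Point O) :=
  ⨅ e : E(G), MeasurableSpace.map (edge O e) inferInstance

theorem isClosed_iff (s : Set (Point O)) :
    IsClosed s ↔ ∀ e : E(G), IsClosed (edge O e ⁻¹' s) := by
  simp only [← isOpen_compl_iff, ← Set.preimage_compl]
  exact isOpen_iSup_iff

theorem measurableSet_iff (s : Set (Point O)) :
    MeasurableSet s ↔ ∀ e : E(G), MeasurableSet (edge O e ⁻¹' s) :=
  MeasurableSpace.measurableSet_iInf

theorem measurable_edge (e : E(G)) : Measurable (edge O e) :=
  fun s hs => (measurableSet_iff O s).1 hs e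

/-- The measure `μ_G`: each edge carries the uniform (Lebesgue) measure of `[0,1]`. -/
noncomputable def graphMeasure : Measure (Point O) :=
  Measure.sum fun e : E(G) => (volume : Measure I).map (edge O e)

end

/-- Riemann integrability of `f : [0,1] → ℝ` (Darboux): for every `ε > 0` there are a partition
`0 = x 0 ≤ x 1 ≤ ⋯ ≤ x n = 1` and lower and upper bounds of `f` on its closed subintervals for
which the upper sum exceeds the lower sum by less than `ε`. -/
def RiemannIntegrable (f : I → ℝ) : Prop :=
  ∀ ε : ℝ, 0 < ε → ∃ (n : ℕ) (x : ℕ → I) (l u : ℕ → ℝ),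
    x 0 = 0 ∧ x n = 1 ∧ Monotone x ∧
    (∀ i < n, ∀ t ∈ Set.Icc (x i) (x (i + 1)), l i ≤ f t ∧ f t ≤ u i) ∧
    ∑ i ∈ Finset.range n, (u i - l i) * ((x (i + 1) : ℝ) - (x i : ℝ)) < ε

section

variable {α β : Type*} {G : Graph α β} (O : EdgeParam G)

/-- The functions on `G` whose restriction to each edge is Riemann integrable. -/
def EdgewiseRiemannIntegrable (f : Point O → ℝ) : Prop :=
  ∀ e : E(G), RiemannIntegrable (f ∘ edge O e)

/-- `X_r(G)`: the (nonempty) closed connected subsets of `G` of measure `r`. -/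
def connectedSets (r : ℝ) : Set (Set (Point O)) :=
  {U | IsClosed U ∧ IsConnected U ∧ (graphMeasure O).real U = r}

/-- The partition set `P(G)`: those `r` for which there are `n ≥ 1` and a nonempty finite family
`U 0, …, U (k-1)` in `X_r(G)` such that every point of `G`, with finitely many exceptions, lies in
exactly `n` members of the family. -/
def partitionSet : Set ℝ :=
  {r | ∃ n k : ℕ, 0 < n ∧ 0 < k ∧ ∃ U : Fin k → Set (Point O),
    (∀ a, U a ∈ connectedSets O r) ∧ {x | {a | x ∈ U a}.ncard ≠ n}.Finite}

/-- The chord set `H(G)`: those `r` such that every edgewise Riemann integrable `f` on `G` with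
`∫_G f = 0` has vanishing integral over some member of `X_r(G)`. -/
def chordSet : Set ℝ :=
  {r | ∀ f : Point O → ℝ, EdgewiseRiemannIntegrable O f → ∫ x, f x ∂(graphMeasure O) = 0 →
    ∃ U ∈ connectedSets O r, ∫ x in U, f x ∂(graphMeasure O) = 0}

end

end MetricGraph

/-! If almost every point lies in exactly `n` members of a finite family, the integrals of `f` over
the members add up to `n ∫ f = 0`. So `f` has integral `≤ 0` over some member `U` and `≥ 0` over
some member `W` (`exists_integral_nonpos_nonneg`).

To pass from `U` to `W` through connected sets of nearly constant measure, the problem is made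
discrete. Every edge is cut into equal short cells, and `U` and `W` are replaced by the unions of
the cells they meet. A set of cells that is connected in the intersection graph of the cells has a
connected union. In a finite connected graph, two connected vertex sets are joined by a chain of
connected sets that gain or lose one vertex at a time and whose sizes hardly leave the range between
the two given sizes (`CutConnected.chain`). One cell contributes little to the integral, so
somewhere along the chain the integral is almost zero (`CutConnected.exists_abs_sum_le`,
`exists_almost_zero`).

Compactness removes the error, and with it the difference between `P(G)` and its closure. A
connected closed set meets each edge in at most two segments (`exists_trace_eq_union`), so it is
described by boundedly many parameters, and a sequence of such sets has a subsequence converging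
almost everywhere to another one (`exists_subseq_ae_eventually`). Dominated convergence carries
measures and integrals to the limit. -/

namespace MetricGraph

/-! ### Connected vertex sets in a finite graph, and chains between them -/

section CutConnected

variable {ι : Type*} (adj : ι → ι → Prop)

/-- A nonempty finite set is cut-connected for the relation `adj` if each of its proper nonempty
subsets is related to its relative complement. -/
def CutConnected (A : Finset ι) : Prop :=
  A.Nonempty ∧ ∀ C ⊂ A, C.Nonempty → ∃ c ∈ C, ∃ b ∈ A, b ∉ C ∧ adj c b

variable {adj}

theorem CutConnected.mono {adj' : ι → ι → Prop} {A : Finset ι} (hA : CutConnected adj A)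
    (h : ∀ a ∈ A, ∀ b ∈ A, adj a b → adj' a b) : CutConnected adj' A := by
  refine ⟨hA.1, fun C hC hne => ?_⟩
  obtain ⟨c, hc, b, hb, hbC, hcb⟩ := hA.2 C hC hne
  exact ⟨c, hc, b, hb, hbC, h c (hC.1 hc) b hb hcb⟩

theorem cutConnected_singleton (v : ι) : CutConnected adj {v} := by
  refine ⟨Finset.singleton_nonempty v, fun C hC hne => ?_⟩
  rw [Finset.ssubset_singleton_iff] at hC
  simp [hC] at hne

variable [DecidableEq ι] (hadj : ∀ a b, adj a b → adj b a)
include hadj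

theorem CutConnected.insert {A : Finset ι} (hA : CutConnected adj A) {c b : ι} (hc : c ∈ A)
    (hcb : adj c b) : CutConnected adj (insert b A) := by
  refine ⟨Finset.insert_nonempty _ _, fun D hD hne => ?_⟩
  by_cases hDA : (D ∩ A).Nonempty
  · by_cases hAD : A ⊆ D
    · refine ⟨c, hAD hc, b, Finset.mem_insert_self _ _, fun hb => hD.2 ?_, hcb⟩
      exact Finset.insert_subset hb hAD
    · have hss : D ∩ A ⊂ A :=
        ⟨Finset.inter_subset_right, fun h => hAD (h.trans Finset.inter_subset_left)⟩
      obtain ⟨x, hx, y, hy, hyD, hxy⟩ := hA.2 _ hss hDA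
      exact ⟨x, (Finset.mem_inter.1 hx).1, y, Finset.mem_insert_of_mem hy,
        fun h => hyD (Finset.mem_inter.2 ⟨h, hy⟩), hxy⟩
  · obtain ⟨d, hd⟩ := hne
    have hdA : d ∉ A := fun h => hDA ⟨d, Finset.mem_inter.2 ⟨hd, h⟩⟩
    have hdb : d = b := (Finset.mem_insert.1 (hD.1 hd)).resolve_right hdA
    exact ⟨b, hdb ▸ hd, c, Finset.mem_insert_of_mem hc,
      fun h => hDA ⟨c, Finset.mem_inter.2 ⟨h, hc⟩⟩, hadj _ _ hcb⟩

/-- A largest cut-connected `D` with `C ⊆ D ⊂ A` can be enlarged by an element of `A` related to it.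
By maximality the result is `A` itself, so `D` is `A` minus one element. -/
theorem CutConnected.exists_erase {A C : Finset ι} (hA : CutConnected adj A)
    (hC : CutConnected adj C) (hCA : C ⊂ A) :
    ∃ a ∈ A, a ∉ C ∧ CutConnected adj (A.erase a) := by
  classical
  obtain ⟨D, hD, hmax⟩ := (A.powerset.filter fun D => CutConnected adj D ∧ C ⊆ D ∧ D ⊂ A)
    |>.exists_max_image Finset.card ⟨C, by simp [hC, hCA, hCA.1]⟩
  simp only [Finset.mem_filter, Finset.mem_powerset] at hD hmax
  obtain ⟨c, hc, b, hb, hbD, hcb⟩ := hA.2 D hD.2.2.2 hD.2.1.1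
  have hins := hD.2.1.insert hadj hc hcb
  have hsub : Insert.insert b D ⊆ A := Finset.insert_subset hb hD.1
  have heq : Insert.insert b D = A := by
    by_contra hne
    have := hmax _ ⟨hsub, hins, hD.2.2.1.trans (Finset.subset_insert _ _),
      hsub.ssubset_of_ne hne⟩
    rw [Finset.card_insert_of_notMem hbD] at this
    omega
  refine ⟨b, hb, fun h => hbD (hD.2.2.1 h), ?_⟩
  rw [← heq, Finset.erase_insert hbD]
  exact hD.2.1

omit hadj in
variable (adj) in
/-- Two cut-connected sets with between `l` and `u` elements, one of which arises from the other by
inserting one element. -/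
def InsertStep (l u : ℕ) (A B : Finset ι) : Prop :=
  CutConnected adj A ∧ CutConnected adj B ∧ l ≤ A.card ∧ l ≤ B.card ∧ A.card ≤ u ∧ B.card ≤ u ∧
    ((∃ a, a ∉ A ∧ B = Insert.insert a A) ∨ (∃ b, b ∉ B ∧ A = Insert.insert b B))

omit hadj in
theorem InsertStep.symm {l u : ℕ} {A B : Finset ι} (h : InsertStep adj l u A B) :
    InsertStep adj l u B A :=
  ⟨h.2.1, h.1, h.2.2.2.1, h.2.2.1, h.2.2.2.2.2.1, h.2.2.2.2.1, h.2.2.2.2.2.2.symm⟩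

omit hadj in
theorem insertStep_chain_symm {l u : ℕ} {A B : Finset ι}
    (h : Relation.ReflTransGen (InsertStep adj l u) A B) :
    Relation.ReflTransGen (InsertStep adj l u) B A :=
  have : Std.Symm (InsertStep adj l u) := ⟨fun _ _ h => h.symm⟩
  Relation.ReflTransGen.stdSymm.symm _ _ h

/-- A cut-connected set can be shrunk to a prescribed size, keeping one of its elements. -/
theorem CutConnected.exists_chain_card_eq {l u : ℕ} (hl : 1 ≤ l) {A : Finset ι}
    (hA : CutConnected adj A) (hlA : l ≤ A.card) (hAu : A.card ≤ u) {v : ι} (hv : v ∈ A) :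
    ∃ B, Relation.ReflTransGen (InsertStep adj l u) A B ∧ CutConnected adj B ∧ B.card = l ∧
      v ∈ B := by
  induction h : A.card - l generalizing A with
  | zero => exact ⟨A, .refl, hA, by omega, hv⟩
  | succ k ih =>
    have hss : ({v} : Finset ι) ⊂ A := by
      refine (Finset.singleton_subset_iff.2 hv).ssubset_of_ne fun h' => ?_
      rw [← h', Finset.card_singleton] at h
      omega
    obtain ⟨a, ha, hav, hc⟩ := hA.exists_erase hadj (cutConnected_singleton v) hss
    have hcard := Finset.card_erase_of_mem ha
    obtain ⟨B, hB, hB'⟩ := ih hc (by omega) (by omega)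
      (Finset.mem_erase.2 ⟨fun h => hav (Finset.mem_singleton.2 h.symm), hv⟩) (by omega)
    exact ⟨B, .head ⟨hA, hc, hlA, by omega, hAu, by omega,
      .inr ⟨a, Finset.notMem_erase _ _, (Finset.insert_erase ha).symm⟩⟩ hB, hB'⟩

/-- Inserting an element and removing another one. -/
theorem CutConnected.chain_swap {l u : ℕ} (hlu : l < u) {A : Finset ι} (hA : CutConnected adj A)
    (hlA : A.card = l) {a b c : ι} (hb : b ∉ A) (hc : c ∈ A) (hcb : adj c b)
    (ha : a ∈ Insert.insert b A) (hAa : CutConnected adj ((Insert.insert b A).erase a)) :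
    Relation.ReflTransGen (InsertStep adj l u) A ((Insert.insert b A).erase a) := by
  have h1 := Finset.card_insert_of_notMem hb
  have h2 := Finset.card_erase_of_mem ha
  have h3 := hA.insert hadj hc hcb
  refine .head (b := Insert.insert b A) ⟨hA, h3, ?_, ?_, ?_, ?_, .inl ⟨b, hb, rfl⟩⟩
    (.single ⟨h3, hAa, ?_, ?_, ?_, ?_,
      .inr ⟨a, Finset.notMem_erase _ _, (Finset.insert_erase ha).symm⟩⟩) <;> omega

/-- The common part `C` grows by an element `b` of `B` related to it. If `b ∉ A`, it is first
swapped into `A` for an element outside `C` whose removal keeps `A` connected. -/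
theorem CutConnected.chain_of_common {l u : ℕ} (hlu : l < u) {A B C : Finset ι}
    (hA : CutConnected adj A) (hB : CutConnected adj B) (hC : CutConnected adj C)
    (hlA : A.card = l) (hlB : B.card = l) (hCA : C ⊆ A) (hCB : C ⊆ B) :
    Relation.ReflTransGen (InsertStep adj l u) A B := by
  induction h : l - C.card generalizing A C with
  | zero =>
    have h1 := Finset.eq_of_subset_of_card_le hCA (by omega)
    have h2 := Finset.eq_of_subset_of_card_le hCB (by omega)
    rw [← h1, ← h2]
  | succ k ih =>
    have hCB' : C ⊂ B := hCB.ssubset_of_ne (by rintro rfl; omega)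
    have hCA' : C ⊂ A := hCA.ssubset_of_ne (by rintro rfl; omega)
    obtain ⟨c, hc, b, hb, hbC, hcb⟩ := hB.2 C hCB' hC.1
    have hCb := hC.insert hadj hc hcb
    have hk : l - (Insert.insert b C).card = k := by
      rw [Finset.card_insert_of_notMem hbC]; omega
    have hsubB := Finset.insert_subset hb hCB
    by_cases hbA : b ∈ A
    · exact ih hA hCb hlA (Finset.insert_subset hbA hCA) hsubB hk
    · obtain ⟨a, ha, haC, hAa⟩ := hA.exists_erase hadj hC hCA'
      have hab : a ≠ b := fun h => hbA (h ▸ ha)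
      have heq : (Insert.insert b A).erase a = Insert.insert b (A.erase a) :=
        Finset.erase_insert_of_ne hab.symm
      have hCa : C ⊆ A.erase a := fun x hx =>
        Finset.mem_erase.2 ⟨fun h => haC (h ▸ hx), hCA hx⟩
      have hnew : CutConnected adj ((Insert.insert b A).erase a) := by
        rw [heq]; exact hAa.insert hadj (hCa hc) hcb
      have haI := Finset.mem_insert_of_mem (b := b) ha
      refine (hA.chain_swap hadj hlu hlA hbA (hCA hc) hcb haI hnew).trans
        (ih hnew hCb ?_ ?_ hsubB hk)
      · rw [Finset.card_erase_of_mem haI, Finset.card_insert_of_notMem hbA]; omega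
      · rw [heq]; exact Finset.insert_subset_insert _ hCa

/-- Both sets are shrunk to size `l`. The one coming from `A` can be moved until it contains any
prescribed element, in particular one of `B'`, and then `chain_of_common` applies with a singleton
as common part. -/
theorem CutConnected.chain [Fintype ι] (huniv : CutConnected adj (Finset.univ : Finset ι))
    {l u : ℕ} (hl : 1 ≤ l) {A B : Finset ι}
    (hA : CutConnected adj A) (hB : CutConnected adj B)
    (hlA : l ≤ A.card) (hlB : l ≤ B.card) (hAu : A.card < u) (hBu : B.card < u) :
    Relation.ReflTransGen (InsertStep adj l u) A B := by
  classical
  obtain ⟨w, hw⟩ := hB.1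
  obtain ⟨B', hBB', hB', hB'l, hwB'⟩ := hB.exists_chain_card_eq hadj hl hlB hBu.le hw
  let R : Finset ι := {v | ∃ A', Relation.ReflTransGen (InsertStep adj l u) A A' ∧
    CutConnected adj A' ∧ A'.card = l ∧ v ∈ A'}
  have hR : R = Finset.univ := by
    by_contra hne
    have hRne : R.Nonempty := by
      obtain ⟨v, hv⟩ := hA.1
      exact ⟨v, by simpa [R] using hA.exists_chain_card_eq hadj hl hlA hAu.le hv⟩
    obtain ⟨c, hc, b, -, hbR, hcb⟩ :=
      huniv.2 R ((Finset.subset_univ R).ssubset_of_ne hne) hRne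
    simp only [R, Finset.mem_filter, Finset.mem_univ, true_and] at hc hbR
    obtain ⟨A', hAA', hA', hA'l, hcA'⟩ := hc
    have hbA' : b ∉ A' := fun h => hbR ⟨A', hAA', hA', hA'l, h⟩
    have hins := hA'.insert hadj hcA' hcb
    -- Removing an element other than `b` restores the size `l`; the swap passes through size `l + 1
    -- ≤ u`.
    obtain ⟨a, ha, hab, hAa⟩ := hins.exists_erase hadj (cutConnected_singleton b)
      ((Finset.singleton_subset_iff.2 (Finset.mem_insert_self _ _)).ssubset_of_ne fun h => by
        have := Finset.mem_insert_of_mem (b := b) hcA'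
        rw [← h, Finset.mem_singleton] at this
        exact hbA' (this ▸ hcA'))
    refine hbR ⟨_, hAA'.trans (hA'.chain_swap hadj (by omega) hA'l hbA' hcA' hcb ha hAa),
      hAa, ?_, ?_⟩
    · rw [Finset.card_erase_of_mem ha, Finset.card_insert_of_notMem hbA']; omega
    · exact Finset.mem_erase.2
        ⟨fun h => hab (Finset.mem_singleton.2 h.symm), Finset.mem_insert_self _ _⟩
  have hwR : w ∈ R := hR ▸ Finset.mem_univ w
  simp only [R, Finset.mem_filter, Finset.mem_univ, true_and] at hwR
  obtain ⟨A', hAA', hA', hA'l, hwA'⟩ := hwR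
  refine (hAA'.trans (hA'.chain_of_common hadj (by omega) hB' (cutConnected_singleton w) hA'l hB'l
    ?_ ?_)).trans (insertStep_chain_symm hBB')
  · simpa using hwA'
  · simpa using hwB'

/-- A discrete intermediate value theorem for cut-connected sets. -/
theorem CutConnected.exists_abs_sum_le [Fintype ι]
    (huniv : CutConnected adj (Finset.univ : Finset ι))
    {l u : ℕ} (hl : 1 ≤ l) {A B : Finset ι}
    (hA : CutConnected adj A) (hB : CutConnected adj B)
    (hlA : l ≤ A.card) (hlB : l ≤ B.card) (hAu : A.card < u) (hBu : B.card < u)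
    (φ : ι → ℝ) {δ η : ℝ} (hη : 0 ≤ η) (hφ : ∀ i, |φ i| ≤ δ) (hφA : ∑ i ∈ A, φ i ≤ η)
    (hφB : -η ≤ ∑ i ∈ B, φ i) :
    ∃ C, CutConnected adj C ∧ l ≤ C.card ∧ C.card ≤ u ∧ |∑ i ∈ C, φ i| ≤ η + δ := by
  by_contra! hno
  have hδ : 0 ≤ δ := by
    obtain ⟨i, -⟩ := hA.1
    exact (abs_nonneg _).trans (hφ i)
  -- A step changes the sum by at most `δ`, so it cannot jump across the forbidden interval `[-(η +
  -- δ), η + δ]`.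
  have key : ∀ C, Relation.ReflTransGen (InsertStep adj l u) A C →
      ∑ i ∈ C, φ i < -(η + δ) := by
    intro C hC
    induction hC with
    | refl =>
      have := hno A hA hlA hAu.le
      rcases lt_abs.1 this with h | h <;> linarith
    | tail _ hs ih =>
      obtain ⟨-, hC', -, hlC, -, hCu, hins⟩ := hs
      have := hno _ hC' hlC hCu
      rcases hins with ⟨a, ha, rfl⟩ | ⟨a, ha, rfl⟩ <;> rw [Finset.sum_insert ha] at * <;>
        have hb := abs_le.1 (hφ a) <;> rcases lt_abs.1 this with h | h <;> linarith
  have := key B (huniv.chain hadj hl hA hB hlA hlB hAu hBu)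
  linarith

end CutConnected

open Set Filter Topology

/-! ### Connected unions of closed sets versus cut-connected index sets -/

section Unions

variable {X ι : Type*} [TopologicalSpace X]

/-- A finite family of nonempty closed sets whose union is connected is cut-connected for the
intersection relation. -/
theorem cutConnected_of_isPreconnected {s : ι → Set X} {A : Finset ι} (hA : A.Nonempty)
    (hs : ∀ i ∈ A, IsClosed (s i)) (hne : ∀ i ∈ A, (s i).Nonempty)
    (h : IsPreconnected (⋃ i ∈ A, s i)) :
    CutConnected (fun i j => (s i ∩ s j).Nonempty) A := by
  classical
  refine ⟨hA, fun C hC hCne => ?_⟩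
  rw [isPreconnected_closed_iff] at h
  obtain ⟨c, hc⟩ := hCne
  obtain ⟨d, hd, hdC⟩ := Finset.exists_of_ssubset hC
  obtain ⟨x, hx⟩ := hne c (hC.1 hc)
  obtain ⟨y, hy⟩ := hne d hd
  obtain ⟨z, -, hz1, hz2⟩ := h (⋃ i ∈ C, s i) (⋃ i ∈ A \ C, s i)
    (isClosed_biUnion_finset fun i hi => hs i (hC.1 hi))
    (isClosed_biUnion_finset fun i hi => hs i (Finset.mem_sdiff.1 hi).1)
    (by
      intro z hz
      simp only [mem_iUnion, mem_union, exists_prop, Finset.mem_sdiff] at hz ⊢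
      obtain ⟨i, hi, hz⟩ := hz
      by_cases hiC : i ∈ C
      · exact .inl ⟨i, hiC, hz⟩
      · exact .inr ⟨i, ⟨hi, hiC⟩, hz⟩)
    ⟨x, mem_biUnion (hC.1 hc) hx, mem_biUnion (t := fun i => s i) (s := (C : Set ι)) hc hx⟩
    ⟨y, mem_biUnion hd hy, mem_biUnion (t := fun i => s i) (s := ((A \ C : Finset ι) : Set ι))
      (Finset.mem_coe.2 (Finset.mem_sdiff.2 ⟨hd, hdC⟩)) hy⟩
  simp only [mem_iUnion, exists_prop, Finset.mem_sdiff] at hz1 hz2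
  obtain ⟨i, hi, hz1⟩ := hz1
  obtain ⟨j, ⟨hj, hjC⟩, hz2⟩ := hz2
  exact ⟨i, hi, j, hj, hjC, z, hz1, hz2⟩

theorem CutConnected.isConnected_biUnion {s : ι → Set X} {A : Finset ι}
    (hA : CutConnected (fun i j => (s i ∩ s j).Nonempty) A) (hs : ∀ i ∈ A, IsConnected (s i)) :
    IsConnected (⋃ i ∈ A, s i) := by
  classical
  refine IsConnected.biUnion_of_reflTransGen (t := (A : Set ι)) hA.1 hs fun i hi j hj => ?_
  set r : ι → ι → Prop := fun i j => (s i ∩ s j).Nonempty ∧ i ∈ (A : Set ι)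
  by_contra hij
  obtain ⟨c, hc, b, hb, hbC, hcb⟩ := hA.2 (A.filter fun k => Relation.ReflTransGen r i k)
    ⟨Finset.filter_subset _ _, fun h => hij (Finset.mem_filter.1 (h hj)).2⟩
    ⟨i, Finset.mem_filter.2 ⟨hi, .refl⟩⟩
  rw [Finset.mem_filter] at hc hbC
  exact hbC ⟨hb, hc.2.tail ⟨hcb, hc.1⟩⟩

end Unions

/-! ### Topology of the graph and traces of connected sets on edges -/

section Topology

variable {α β : Type*} {G : Graph α β} {O : EdgeParam G}

theorem continuous_edge (e : E(G)) : Continuous (edge O e) :=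
  continuous_iSup_rng (i := e) continuous_coinduced_rng

theorem edge_of_mem {e : E(G)} {t : I} (h : (t : ℝ) ∈ Ioo (0 : ℝ) 1) :
    edge O e t = Point.interior e ⟨t, h⟩ := dif_pos h

theorem edge_zero (e : E(G)) : edge O e 0 = Point.vertex (O.src e) := by
  simp [edge]

theorem edge_one (e : E(G)) : edge O e 1 = Point.vertex (O.tgt e) := by
  simp [edge]

theorem mem_Ioo_or (t : I) : (t : ℝ) ∈ Ioo (0 : ℝ) 1 ∨ t = 0 ∨ t = 1 := by
  rcases eq_or_ne t 0 with h | h0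
  · exact .inr (.inl h)
  rcases eq_or_ne t 1 with h | h1
  · exact .inr (.inr h)
  exact .inl ⟨unitInterval.pos_iff_ne_zero.2 h0, unitInterval.lt_one_iff_ne_one.2 h1⟩

theorem edge_eq_edge {e e' : E(G)} {t s : I} (ht : (t : ℝ) ∈ Ioo (0 : ℝ) 1) :
    edge O e t = edge O e' s ↔ e = e' ∧ t = s := by
  constructor
  · intro h
    rw [edge_of_mem ht] at h
    rcases mem_Ioo_or s with hs | rfl | rfl
    · rw [edge_of_mem hs] at h
      injection h with h1 h2
      exact ⟨h1, Subtype.ext (by simpa using h2)⟩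
    · rw [edge_zero] at h; cases h
    · rw [edge_one] at h; cases h
  · rintro ⟨rfl, rfl⟩; rfl

theorem finite_boundary : ({0, 1} : Set I).Finite := by simp

theorem notMem_boundary {t : I} (ht : (t : ℝ) ∈ Ioo (0 : ℝ) 1) : t ∉ ({0, 1} : Set I) := by
  rintro (rfl | rfl) <;> simp at ht

/-- Gluing affects only the parameters `0` and `1`, so a trace differs from the expected closed set
by finitely many points. -/
theorem isClosed_of_interior {P S : Set I} (hS : IsClosed S) (hSP : S ⊆ P)
    (h : ∀ t ∈ P, (t : ℝ) ∈ Ioo (0 : ℝ) 1 → t ∈ S) : IsClosed P := by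
  have : P = S ∪ (P ∩ {0, 1}) := by
    refine Subset.antisymm (fun t ht => ?_) (union_subset hSP inter_subset_left)
    rcases mem_Ioo_or t with h' | h'
    · exact .inl (h t ht h')
    · exact .inr ⟨ht, h'⟩
  rw [this]
  exact hS.union (finite_boundary.subset inter_subset_right).isClosed

theorem isClosed_image_edge (e : E(G)) {K : Set I} (hK : IsClosed K) :
    IsClosed (edge O e '' K) := by
  refine (isClosed_iff O _).2 fun e' => ?_
  by_cases he : e' = e
  · subst he
    refine isClosed_of_interior hK (subset_preimage_image _ _) ?_
    rintro t ⟨s, hs, hst⟩ ht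
    rw [((edge_eq_edge ht).1 hst.symm).2]
    exact hs
  · refine isClosed_of_interior isClosed_empty (empty_subset _) ?_
    rintro t ⟨s, hs, hst⟩ ht
    exact he ((edge_eq_edge ht).1 hst.symm).1

/-- Apart from the diagonal (when `e = e'`), only pairs of end parameters are identified. Closedness
lets common points of two segments survive a limit in the compactness argument. -/
theorem isClosed_setOf_edge_eq (e e' : E(G)) :
    IsClosed {p : I × I | edge O e p.1 = edge O e' p.2} := by
  have hfin : ({0, 1} ×ˢ {0, 1} : Set (I × I)).Finite := finite_boundary.prod finite_boundary
  have key : ∀ p : I × I, edge O e p.1 = edge O e' p.2 →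
      (e = e' ∧ p.1 = p.2) ∨ p ∈ ({0, 1} ×ˢ {0, 1} : Set (I × I)) := by
    rintro ⟨t, s⟩ h
    rcases mem_Ioo_or t with ht | ht
    · exact .inl ((edge_eq_edge ht).1 h)
    rcases mem_Ioo_or s with hs | hs
    · obtain ⟨h1, h2⟩ := (edge_eq_edge hs).1 h.symm
      exact .inl ⟨h1.symm, h2.symm⟩
    · exact .inr ⟨ht, hs⟩
  set R := {p : I × I | edge O e p.1 = edge O e' p.2} with hR
  have hRB : IsClosed (R ∩ ({0, 1} ×ˢ {0, 1} : Set (I × I))) :=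
    (hfin.subset inter_subset_right).isClosed
  by_cases he : e = e'
  · subst he
    have : R = {p : I × I | p.1 = p.2} ∪ (R ∩ ({0, 1} ×ˢ {0, 1} : Set (I × I))) := by
      refine Subset.antisymm (fun p hp => ?_) (union_subset ?_ inter_subset_left)
      · rcases key p hp with h | h
        · exact .inl h.2
        · exact .inr ⟨hp, h⟩
      · intro p hp
        exact congrArg (edge O e) hp
    rw [this]
    exact (isClosed_eq continuous_fst continuous_snd).union hRB
  · have : R = R ∩ ({0, 1} ×ˢ {0, 1} : Set (I × I)) :=
      (inter_eq_left.2 fun p hp => (key p hp).resolve_left fun h => he h.1).symm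
    rw [this]
    exact hRB

theorem eq_src_or_eq_tgt_of_inc (O : EdgeParam G) (e : E(G)) {v : V(G)} (h : G.Inc (e : β) (v : α)) :
    v = O.src e ∨ v = O.tgt e := by
  obtain ⟨w, hw⟩ := h
  rcases hw.left_eq_or_eq (O.isLink e) with h | h
  · exact .inl (Subtype.ext h)
  · exact .inr (Subtype.ext h)

theorem exists_edge_eq_vertex (O : EdgeParam G) (e : E(G)) {v : V(G)}
    (h : G.Inc (e : β) (v : α)) : Point.vertex v ∈ range (edge O e) := by
  rcases eq_src_or_eq_tgt_of_inc O e h with rfl | rfl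
  · exact ⟨0, edge_zero e⟩
  · exact ⟨1, edge_one e⟩

theorem isConnected_range_edge (e : E(G)) : IsConnected (range (edge O e)) :=
  isConnected_range (continuous_edge e)

theorem vertex_mem_connectedComponent (O : EdgeParam G) {x y : α} (hx : x ∈ V(G))
    (h : Relation.ReflTransGen G.Adj x y) :
    ∃ hy : y ∈ V(G), (Point.vertex ⟨y, hy⟩ : Point O) ∈
      connectedComponent (Point.vertex ⟨x, hx⟩ : Point O) := by
  induction h with
  | refl => exact ⟨hx, mem_connectedComponent⟩
  | @tail y z _ hyz ih =>
    obtain ⟨hy, ih⟩ := ih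
    obtain ⟨e, he⟩ := hyz
    refine ⟨he.right_mem, ?_⟩
    rw [connectedComponent_eq ih]
    exact (isConnected_range_edge (O := O) ⟨e, he.edge_mem⟩).isPreconnected.subset_connectedComponent
      (exists_edge_eq_vertex O ⟨e, he.edge_mem⟩ ⟨z, he⟩)
      (exists_edge_eq_vertex O ⟨e, he.edge_mem⟩ ⟨y, he.symm⟩)

theorem connectedSpace_point (hG : IsConnectedGraph G) (O : EdgeParam G) :
    ConnectedSpace (Point O) := by
  obtain ⟨v, hv⟩ := hG.1
  have hvert : ∀ w : V(G), (Point.vertex w : Point O) ∈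
      connectedComponent (Point.vertex ⟨v, hv⟩ : Point O) := fun w =>
    (vertex_mem_connectedComponent O hv (hG.2 v hv w w.2)).2
  refine connectedSpace_iff_connectedComponent.2 ⟨Point.vertex ⟨v, hv⟩, eq_univ_of_forall ?_⟩
  rintro (w | ⟨e, t⟩)
  · exact hvert w
  · rw [connectedComponent_eq (hvert (O.src e))]
    exact (isConnected_range_edge (O := O) e).isPreconnected.subset_connectedComponent
      ⟨0, edge_zero e⟩ ⟨⟨t, t.2.1.le, t.2.2.le⟩, edge_of_mem t.2⟩

/-- In a connected graph with an edge, every point lies on an edge. -/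
theorem exists_edge_eq (hG : IsConnectedGraph G) (O : EdgeParam G) [Nonempty E(G)] (x : Point O) :
    ∃ e t, edge O e t = x := by
  rcases x with v | ⟨e, t⟩
  · obtain ⟨e⟩ := ‹Nonempty E(G)›
    rcases Relation.ReflTransGen.cases_head (hG.2 v v.2 _ (O.src e).2) with h | ⟨w, ⟨e', h⟩, -⟩
    · exact ⟨e, 0, by rw [edge_zero, Subtype.ext h]⟩
    · exact ⟨_, exists_edge_eq_vertex O ⟨e', h.edge_mem⟩ ⟨w, h⟩⟩
  · exact ⟨e, ⟨t, t.2.1.le, t.2.2.le⟩, edge_of_mem t.2⟩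

/-- If a connected set contains an interior point of a segment of an edge whose ends it
avoids, it is contained in the segment. -/
theorem preimage_edge_subset_Ioo {U : Set (Point O)} (hc : IsPreconnected U)
    {e : E(G)} {x t y : I} (hxt : x < t) (hty : t < y) (hx : edge O e x ∉ U) (hy : edge O e y ∉ U)
    (ht : edge O e t ∈ U) : edge O e ⁻¹' U ⊆ Ioo x y := by
  rw [isPreconnected_closed_iff] at hc
  intro s hs
  by_contra hsxy
  have hinner : ∀ p ∈ Ioo x y, (p : ℝ) ∈ Ioo (0 : ℝ) 1 := fun p hp =>
    ⟨x.2.1.trans_lt hp.1, lt_of_lt_of_le (show (p : ℝ) < y from hp.2) y.2.2⟩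
  -- The closed arc and the complement of the open arc are closed and cover `G`. They meet only in
  -- the two end points, which `U` avoids, so `U` cannot meet both.
  have hCcl : IsClosed ((edge O e '' Ioo x y)ᶜ) := by
    refine (isClosed_iff O _).2 fun e' => ?_
    rw [preimage_compl, isClosed_compl_iff]
    by_cases he : e' = e
    · subst he
      have : edge O e' ⁻¹' (edge O e' '' Ioo x y) = Ioo x y := by
        refine Subset.antisymm ?_ (subset_preimage_image _ _)
        rintro p ⟨q, hq, hqp⟩
        rw [← ((edge_eq_edge (hinner q hq)).1 hqp).2]
        exact hq
      rw [this]
      exact isOpen_Ioo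
    · have : edge O e' ⁻¹' (edge O e '' Ioo x y) = ∅ := by
        refine eq_empty_of_forall_notMem ?_
        rintro p ⟨q, hq, hqp⟩
        exact he ((edge_eq_edge (hinner q hq)).1 hqp).1.symm
      rw [this]
      exact isOpen_empty
  obtain ⟨z, hzU, ⟨p, hp, rfl⟩, hz2⟩ := hc _ _ (isClosed_image_edge (O := O) e isClosed_Icc) hCcl
    (fun z _ => by
      by_cases hz : z ∈ edge O e '' Ioo x y
      · exact .inl (image_mono Ioo_subset_Icc_self hz)
      · exact .inr hz)
    ⟨_, ht, mem_image_of_mem _ ⟨hxt.le, hty.le⟩⟩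
    ⟨_, hs, by
      rintro ⟨q, hq, hqs⟩
      rw [((edge_eq_edge (hinner q hq)).1 hqs).2] at hq
      exact hsxy hq⟩
  refine hz2 (mem_image_of_mem _ ⟨lt_of_le_of_ne hp.1 ?_, lt_of_le_of_ne hp.2 ?_⟩)
  · rintro rfl; exact hx hzU
  · rintro rfl; exact hy hzU

/-- The trace of a connected closed set on an edge consists of at most two segments. -/
theorem exists_trace_eq_union {U : Set (Point O)} (hU : IsClosed U) (hc : IsPreconnected U)
    (e : E(G)) : ∃ S : Bool → Set I, (∀ i, IsClosed (S i) ∧ (S i).OrdConnected) ∧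
      edge O e ⁻¹' U = ⋃ i, S i := by
  have hT : IsClosed (edge O e ⁻¹' U) := (isClosed_iff O U).1 hU e
  set T := edge O e ⁻¹' U with hTdef
  by_cases hord : T.OrdConnected
  · exact ⟨fun _ => T, fun _ => ⟨hT, hord⟩, (iUnion_const T).symm⟩
  · obtain ⟨s, hs, u, hu, z, hz, hzT⟩ : ∃ s ∈ T, ∃ u ∈ T, ∃ z ∈ Icc s u, z ∉ T := by
      by_contra! h
      exact hord ⟨fun s hs u hu z hz => h s hs u hu z hz⟩
    have hsz : s < z := lt_of_le_of_ne hz.1 (by rintro rfl; exact hzT hs)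
    have hzu : z < u := lt_of_le_of_ne hz.2 (by rintro rfl; exact hzT hu)
    -- Otherwise `T` is confined to `(x, y)`, hence `x < s < z`, and then to `(x, z)`, although `u >
    -- z` is in `T`. So `T` has no isolated middle piece, and cutting at the gap `z` leaves two
    -- convex parts.
    have key : ∀ x t y, x < t → t < y → x ∉ T → y ∉ T → t ∉ T := by
      intro x t y hxt hty hx hy ht
      have hsub : T ⊆ Ioo x y := preimage_edge_subset_Ioo hc hxt hty hx hy ht
      exact (preimage_edge_subset_Ioo hc (hsub hs).1 hsz hx hzT hs hu).2.not_gt hzu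
    refine ⟨fun b => if b then T ∩ Iic z else T ∩ Ici z, fun b => ?_, ?_⟩
    · cases b
      · refine ⟨by simpa using hT.inter isClosed_Ici, ⟨fun p hp q hq r hr => ?_⟩⟩
        simp only [Bool.false_eq_true, if_false, mem_inter_iff, mem_Ici] at hp hq ⊢
        refine ⟨?_, hp.2.trans hr.1⟩
        by_contra hrT
        rcases hp.2.eq_or_lt with rfl | hzp
        · exact hzT hp.1
        · refine key z p r hzp (lt_of_le_of_ne hr.1 ?_) hzT hrT hp.1
          rintro rfl; exact hrT hp.1
      · refine ⟨by simpa using hT.inter isClosed_Iic, ⟨fun p hp q hq r hr => ?_⟩⟩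
        simp only [if_true, mem_inter_iff, mem_Iic] at hp hq ⊢
        refine ⟨?_, hr.2.trans hq.2⟩
        by_contra hrT
        rcases hq.2.eq_or_lt with rfl | hzp
        · exact hzT hq.1
        · refine key r q z (lt_of_le_of_ne hr.2 ?_) hzp hrT hzT hq.1
          rintro rfl; exact hrT hq.1
    · ext t
      simp only [mem_iUnion, Bool.exists_bool, Bool.false_eq_true, if_false, if_true,
        mem_inter_iff, mem_Ici, mem_Iic]
      have := le_total z t
      tauto

theorem exists_eq_Icc {S : Set I} (hS : IsClosed S) (ho : S.OrdConnected) (hne : S.Nonempty) :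
    ∃ a b, a ≤ b ∧ S = Icc a b := by
  have hcomp := hS.isCompact
  have ha := hcomp.sInf_mem hne
  have hb := hcomp.sSup_mem hne
  have hsub : S ⊆ Icc (sInf S) (sSup S) := fun t ht => ⟨sInf_le ht, le_sSup ht⟩
  exact ⟨sInf S, sSup S, (hsub ha).2, hsub.antisymm (ho.out ha hb)⟩

/-- The trace of a connected closed set on an edge, as a union of at most two segments. -/
theorem exists_trace_eq_Icc {U : Set (Point O)} (hU : IsClosed U) (hc : IsPreconnected U)
    (e : E(G)) : ∃ (a b : Bool → I) (q : Bool → Bool), (∀ i, q i = true → a i ≤ b i) ∧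
      ∀ t, edge O e t ∈ U ↔ ∃ i, q i = true ∧ t ∈ Icc (a i) (b i) := by
  classical
  obtain ⟨S, hS, hT⟩ := exists_trace_eq_union hU hc e
  have : ∀ i, ∃ (a b : I) (q : Bool), (q = true → a ≤ b) ∧
      ∀ t, t ∈ S i ↔ q = true ∧ t ∈ Icc a b := by
    intro i
    rcases (S i).eq_empty_or_nonempty with h | h
    · exact ⟨0, 0, false, by simp, by simp [h]⟩
    · obtain ⟨a, b, hab, h⟩ := exists_eq_Icc (hS i).1 (hS i).2 h
      exact ⟨a, b, true, fun _ => hab, by simp [h]⟩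
  choose a b q hab hq using this
  refine ⟨a, b, q, hab, fun t => ?_⟩
  rw [← mem_preimage, hT, mem_iUnion]
  simp only [hq]

end Topology

/-! ### Darboux integrable functions are bounded and a.e. measurable -/

section RiemannIntegrable

theorem exists_mem_Ico_of_monotone {x : ℕ → I} {n : ℕ} (h0 : x 0 = 0) (hn : x n = 1) {t : I}
    (ht : t < 1) : ∃ j < n, t ∈ Ico (x j) (x (j + 1)) := by
  classical
  have hex : ∃ k, t < x k := ⟨n, hn ▸ ht⟩
  obtain ⟨k, hk⟩ : ∃ k, Nat.find hex = k + 1 := by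
    refine Nat.exists_eq_succ_of_ne_zero fun h => ?_
    have := Nat.find_spec hex
    rw [h, h0] at this
    exact this.not_ge t.2.1
  refine ⟨k, ?_, ?_, hk ▸ Nat.find_spec hex⟩
  · have : Nat.find hex ≤ n := Nat.find_min' hex (hn ▸ ht)
    omega
  · exact not_lt.1 (Nat.find_min hex (by omega))

theorem sum_indicator_Ico {M : Type*} [AddCommMonoid M] {x : ℕ → I} (hx : Monotone x) {n j : ℕ}
    (hj : j < n) {t : I} (ht : t ∈ Ico (x j) (x (j + 1))) (c : ℕ → M) :
    ∑ i ∈ Finset.range n, (Ico (x i) (x (i + 1))).indicator (fun _ => c i) t = c j := by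
  rw [Finset.sum_eq_single j]
  · exact indicator_of_mem ht _
  · intro i _ hij
    refine indicator_of_notMem (fun hi => ?_) _
    rcases lt_or_gt_of_ne hij with h | h
    · exact (hi.2.trans_le (hx h)).not_ge ht.1
    · exact (ht.2.trans_le (hx h)).not_ge hi.1
  · intro h
    exact absurd (Finset.mem_range.2 hj) h

theorem RiemannIntegrable.exists_bound {f : I → ℝ} (hf : RiemannIntegrable f) :
    ∃ M, ∀ t, |f t| ≤ M := by
  obtain ⟨n, x, l, u, h0, hn, hx, hlu, -⟩ := hf 1 one_pos
  refine ⟨∑ i ∈ Finset.range n, (|l i| + |u i|) + |f 1|, fun t => ?_⟩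
  have hnn : 0 ≤ ∑ i ∈ Finset.range n, (|l i| + |u i|) :=
    Finset.sum_nonneg fun i _ => by positivity
  rcases t.2.2.eq_or_lt with h | h
  · have : t = 1 := Subtype.ext h
    rw [this]; linarith
  · obtain ⟨j, hj, hjt⟩ := exists_mem_Ico_of_monotone h0 hn (t := t) h
    have hb := hlu j hj t ⟨hjt.1, hjt.2.le⟩
    have hs := Finset.single_le_sum (f := fun i => |l i| + |u i|) (fun i _ => by positivity)
      (Finset.mem_range.2 hj)
    have h1 : |f t| ≤ |l j| + |u j| := by
      rw [abs_le]
      constructor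
      · linarith [neg_abs_le (l j), abs_nonneg (u j)]
      · linarith [le_abs_self (u j), abs_nonneg (l j)]
    linarith [abs_nonneg (f 1)]

/-- `L` is the lower step function and `D` the gap between upper and lower bounds. Half-open
intervals make the pieces disjoint, at the price of missing the point `1`. -/
theorem RiemannIntegrable.exists_step {f : I → ℝ} (hf : RiemannIntegrable f) {ε : ℝ}
    (hε : 0 < ε) : ∃ (L : I → ℝ) (D : I → ENNReal), Measurable L ∧ Measurable D ∧
      (∀ t, t < 1 → edist (L t) (f t) ≤ D t) ∧ ∫⁻ t, D t ≤ ENNReal.ofReal ε := by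
  obtain ⟨n, x, l, u, h0, hn, hx, hlu, hsum⟩ := hf ε hε
  have hle : ∀ i, (x i : ℝ) ≤ x (i + 1) := fun i => hx (Nat.le_succ i)
  have hlu0 : ∀ i < n, 0 ≤ u i - l i := fun i hi => by
    have := hlu i hi (x i) ⟨le_rfl, hle i⟩
    linarith
  refine ⟨fun t => ∑ i ∈ Finset.range n, (Ico (x i) (x (i + 1))).indicator (fun _ => l i) t,
    fun t => ∑ i ∈ Finset.range n,
      (Ico (x i) (x (i + 1))).indicator (fun _ => ENNReal.ofReal (u i - l i)) t,
    Finset.measurable_fun_sum _ fun i _ => measurable_const.indicator measurableSet_Ico,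
    Finset.measurable_fun_sum _ fun i _ => measurable_const.indicator measurableSet_Ico,
    fun t ht => ?_, ?_⟩
  · obtain ⟨j, hj, hjt⟩ := exists_mem_Ico_of_monotone h0 hn ht
    beta_reduce
    rw [sum_indicator_Ico hx hj hjt, sum_indicator_Ico hx hj hjt, edist_dist, Real.dist_eq]
    refine ENNReal.ofReal_le_ofReal ?_
    have hb := hlu j hj t ⟨hjt.1, hjt.2.le⟩
    rw [abs_le]
    constructor <;> linarith
  · rw [lintegral_finsetSum _ fun i _ => measurable_const.indicator measurableSet_Ico]
    simp only [lintegral_indicator_const measurableSet_Ico, unitInterval.volume_Ico]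
    refine le_trans (le_of_eq ?_) (ENNReal.ofReal_le_ofReal hsum.le)
    rw [ENNReal.ofReal_sum_of_nonneg fun i hi =>
      mul_nonneg (hlu0 i (Finset.mem_range.1 hi)) (sub_nonneg.2 (hle i))]
    exact Finset.sum_congr rfl fun i hi =>
      (ENNReal.ofReal_mul (hlu0 i (Finset.mem_range.1 hi))).symm

/-- By Markov's inequality for the gaps `D k`, the lower step functions converge to `f` in measure.
-/
theorem RiemannIntegrable.aemeasurable {f : I → ℝ} (hf : RiemannIntegrable f) :
    AEMeasurable f volume := by
  choose L D hL hD hLD hDint using fun k : ℕ => hf.exists_step (ε := 1 / ((k : ℝ) + 1))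
    Nat.one_div_pos_of_nat
  refine TendstoInMeasure.aemeasurable (u := atTop) (fun k => (hL k).aemeasurable)
    (tendstoInMeasure_of_ne_top fun ε hε hεt => ?_)
  have hlim : Tendsto (fun k : ℕ => ENNReal.ofReal (1 / ((k : ℝ) + 1)) / ε) atTop (𝓝 0) := by
    have := ENNReal.Tendsto.div_const (b := ε)
      (ENNReal.tendsto_ofReal tendsto_one_div_add_atTop_nhds_zero_nat) (.inr hε.ne')
    simpa using this
  refine tendsto_of_tendsto_of_tendsto_of_le_of_le tendsto_const_nhds hlim (fun _ => zero_le)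
    fun k => ?_
  calc volume {t | ε ≤ edist (L k t) (f t)}
      ≤ volume {t | ε ≤ D k t} := by
        refine measure_mono_ae ?_
        have h1 : ∀ᵐ t : I, t ≠ 1 := by simp [ae_iff]
        filter_upwards [h1] with t ht h
        exact le_trans h (hLD k t (unitInterval.lt_one_iff_ne_one.2 ht))
    _ ≤ (∫⁻ t, D k t) / ε := meas_ge_le_lintegral_div (hD k).aemeasurable hε.ne' hεt
    _ ≤ _ := ENNReal.div_le_div_right (hDint k) _

end RiemannIntegrable

/-! ### The graph measure and integrability on the graph -/

section Measure

variable {α β : Type*} {G : Graph α β} {O : EdgeParam G}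

theorem measurableSet_of_isClosed {U : Set (Point O)} (hU : IsClosed U) : MeasurableSet U :=
  (measurableSet_iff O U).2 fun e => ((isClosed_iff O U).1 hU e).measurableSet

theorem injOn_edge (e : E(G)) : InjOn (edge O e) {t | (t : ℝ) ∈ Ioo (0 : ℝ) 1} :=
  fun _ ht _ _ h => ((edge_eq_edge ht).1 h).2

theorem finite_preimage_edge (e : E(G)) {s : Set (Point O)} (hs : s.Finite) :
    (edge O e ⁻¹' s).Finite := by
  have h1 : ((edge O e ⁻¹' s) ∩ {t | (t : ℝ) ∈ Ioo (0 : ℝ) 1}).Finite :=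
    Finite.of_finite_image (hs.subset (by rintro _ ⟨t, ht, rfl⟩; exact ht.1))
      ((injOn_edge e).mono inter_subset_right)
  refine (h1.union finite_boundary).subset fun t ht => ?_
  rcases mem_Ioo_or t with h | h
  · exact .inl ⟨ht, h⟩
  · exact .inr h

theorem isClosed_of_finite {s : Set (Point O)} (hs : s.Finite) : IsClosed s :=
  (isClosed_iff O s).2 fun e => (finite_preimage_edge e hs).isClosed

theorem graphMeasure_apply {s : Set (Point O)} (hs : MeasurableSet s) :
    graphMeasure O s = ∑' e, volume (edge O e ⁻¹' s) := by
  rw [graphMeasure, Measure.sum_apply _ hs]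
  exact tsum_congr fun e => Measure.map_apply (measurable_edge O e) hs

theorem graphMeasure_finite {s : Set (Point O)} (hs : s.Finite) : graphMeasure O s = 0 := by
  rw [graphMeasure_apply (measurableSet_of_isClosed (isClosed_of_finite hs))]
  simp [(finite_preimage_edge _ hs).measure_zero]

instance isFiniteMeasure_graphMeasure [Finite E(G)] : IsFiniteMeasure (graphMeasure O) := by
  cases nonempty_fintype E(G)
  refine ⟨?_⟩
  rw [graphMeasure_apply MeasurableSet.univ, tsum_fintype]
  exact ENNReal.sum_lt_top.2 fun e _ => measure_lt_top _ _

theorem finite_range_vertex [Finite V(G)] : (range (Point.vertex : V(G) → Point O)).Finite :=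
  finite_range _

/-- A property holding at all but finitely many interior points of each edge holds a.e. -/
theorem ae_graphMeasure [Finite V(G)] [Finite E(G)] {p : Point O → Prop} {B : E(G) → Set I}
    (hB : ∀ e, (B e).Finite)
    (h : ∀ e (t : I), (t : ℝ) ∈ Ioo (0 : ℝ) 1 → t ∉ B e → p (edge O e t)) :
    ∀ᵐ x ∂(graphMeasure O), p x := by
  refine measure_mono_null ?_ (graphMeasure_finite (O := O) (finite_range_vertex.union
    (finite_iUnion fun e => (hB e).image (edge O e))))
  rintro (v | ⟨e, t⟩) hx
  · exact .inl ⟨v, rfl⟩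
  · have hte := edge_of_mem (O := O) (e := e) (t := ⟨t, t.2.1.le, t.2.2.le⟩) t.2
    refine .inr (mem_iUnion.2 ⟨e, ⟨t, t.2.1.le, t.2.2.le⟩, ?_, hte⟩)
    by_contra htB
    have := h e _ t.2 htB
    rw [hte] at this
    exact hx this

theorem graphMeasure_image_Icc (e : E(G)) (a b : I) :
    graphMeasure O (edge O e '' Icc a b) = ENNReal.ofReal (b - a) := by
  rw [graphMeasure_apply (measurableSet_of_isClosed (isClosed_image_edge e isClosed_Icc)),
    tsum_eq_single e, ← unitInterval.volume_Icc]
  · refine le_antisymm ?_ (measure_mono (subset_preimage_image _ _))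
    calc volume (edge O e ⁻¹' (edge O e '' Icc a b)) ≤ volume (Icc a b ∪ {0, 1}) := by
          refine measure_mono ?_
          rintro t ⟨s, hs, hst⟩
          rcases mem_Ioo_or t with ht | ht
          · exact .inl (((edge_eq_edge ht).1 hst.symm).2 ▸ hs)
          · exact .inr ht
      _ ≤ volume (Icc a b) + volume ({0, 1} : Set I) := measure_union_le _ _
      _ = volume (Icc a b) := by rw [finite_boundary.measure_zero, add_zero]
  · intro e' he
    refine (finite_boundary.subset ?_).measure_zero _
    rintro t ⟨s, hs, hst⟩
    rcases mem_Ioo_or t with ht | ht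
    · exact absurd ((edge_eq_edge ht).1 hst.symm).1 he
    · exact ht

theorem exists_bound [Finite E(G)] (hcov : ∀ x : Point O, ∃ e t, edge O e t = x)
    {f : Point O → ℝ} (hf : EdgewiseRiemannIntegrable O f) : ∃ M, ∀ x, |f x| ≤ M := by
  cases nonempty_fintype E(G)
  choose M hM using fun e => (hf e).exists_bound
  refine ⟨∑ e, |M e|, fun x => ?_⟩
  obtain ⟨e, t, rfl⟩ := hcov x
  exact ((hM e t).trans (le_abs_self _)).trans
    (Finset.single_le_sum (f := fun e => |M e|) (fun _ _ => abs_nonneg _) (Finset.mem_univ e))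

theorem aestronglyMeasurable [Finite V(G)] [Finite E(G)]
    {f : Point O → ℝ} (hf : EdgewiseRiemannIntegrable O f) :
    AEStronglyMeasurable f (graphMeasure O) := by
  choose g hg hfg using fun e => (hf e).aemeasurable
  -- Measurable representatives on the edges are glued, with value `0` at vertices. The exceptional
  -- set `Z` holds all vertices and a measurable null set `N e` on each edge.
  set h : Point O → ℝ := fun x => match x with
    | .vertex _ => 0
    | .interior e t => g e ⟨t, t.2.1.le, t.2.2.le⟩
  set N := fun e => toMeasurable volume {t | (f ∘ edge O e) t ≠ g e t}
  set Z : Set (Point O) := {x | match x with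
    | .vertex _ => True
    | .interior e t => (⟨t, t.2.1.le, t.2.2.le⟩ : I) ∈ N e}
  have hint : MeasurableSet {t : I | (t : ℝ) ∈ Ioo (0 : ℝ) 1} :=
    measurable_subtype_coe measurableSet_Ioo
  have hedge : ∀ e, h ∘ edge O e = {t : I | (t : ℝ) ∈ Ioo (0 : ℝ) 1}.indicator (g e) := by
    intro e
    ext t
    rcases mem_Ioo_or t with ht | rfl | rfl
    · rw [indicator_of_mem (show t ∈ {t : I | (t : ℝ) ∈ Ioo (0 : ℝ) 1} from ht), Function.comp_apply, edge_of_mem ht]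
    · rw [indicator_of_notMem (by simp), Function.comp_apply, edge_zero]
    · rw [indicator_of_notMem (by simp), Function.comp_apply, edge_one]
  have hZ : ∀ e, edge O e ⁻¹' Z = (N e ∩ {t : I | (t : ℝ) ∈ Ioo (0 : ℝ) 1}) ∪ {0, 1} := by
    intro e
    ext t
    rcases mem_Ioo_or t with ht | rfl | rfl
    · simp only [mem_preimage, edge_of_mem ht, Z, mem_ofPred_eq, mem_union, mem_inter_iff, ht,
        and_true, notMem_boundary ht, or_false]
    · simp [edge_zero, Z]
    · simp [edge_one, Z]
  have hZm : MeasurableSet Z := (measurableSet_iff O Z).2 fun e => by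
    rw [hZ]
    exact ((measurableSet_toMeasurable _ _).inter hint).union finite_boundary.measurableSet
  refine AEMeasurable.aestronglyMeasurable ⟨h, fun s hs => ?_, ?_⟩
  · refine (measurableSet_iff O _).2 fun e => ?_
    rw [← preimage_comp, hedge]
    exact ((hg e).indicator hint) hs
  · refine measure_mono_null (t := Z) ?_ ?_
    · rintro (v | ⟨e, t⟩) hx
      · exact trivial
      · refine subset_toMeasurable _ _ ?_
        simp only [mem_ofPred_eq, Function.comp_apply]
        rwa [edge_of_mem t.2]
    · rw [graphMeasure_apply hZm, ENNReal.tsum_eq_zero]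
      intro e
      rw [hZ]
      refine measure_union_null (measure_mono_null inter_subset_left ?_)
        (finite_boundary.measure_zero _)
      rw [measure_toMeasurable]
      exact hfg e

theorem integrable [Finite V(G)] [Finite E(G)] (hcov : ∀ x : Point O, ∃ e t, edge O e t = x)
    {f : Point O → ℝ} (hf : EdgewiseRiemannIntegrable O f) : Integrable f (graphMeasure O) := by
  obtain ⟨M, hM⟩ := exists_bound hcov hf
  exact Integrable.of_bound (aestronglyMeasurable hf) M (ae_of_all _ hM)

end Measure

/-! ### Set integrals under almost everywhere convergence of sets -/

section SetIntegral

variable {X : Type*} [MeasurableSpace X] {μ : Measure X} {f : X → ℝ}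

theorem tendsto_setIntegral_of_ae (hf : Integrable f μ) {S : ℕ → Set X} {T : Set X}
    (hS : ∀ n, MeasurableSet (S n)) (hT : MeasurableSet T)
    (h : ∀ᵐ x ∂μ, ∀ᶠ n in atTop, (x ∈ S n ↔ x ∈ T)) :
    Tendsto (fun n => ∫ x in S n, f x ∂μ) atTop (𝓝 (∫ x in T, f x ∂μ)) := by
  classical
  simp only [← integral_indicator hT, ← integral_indicator (hS _)]
  refine tendsto_integral_of_dominated_convergence (fun x => ‖f x‖)
    (fun n => hf.1.indicator (hS n)) hf.norm
    (fun n => ae_of_all _ fun x => norm_indicator_le_norm_self f x) ?_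
  filter_upwards [h] with x hx
  refine tendsto_const_nhds.congr' ?_
  filter_upwards [hx] with n hn
  simp only [indicator_apply, hn]

theorem tendsto_measureReal_of_ae [IsFiniteMeasure μ] {S : ℕ → Set X} {T : Set X}
    (hS : ∀ n, MeasurableSet (S n)) (hT : MeasurableSet T)
    (h : ∀ᵐ x ∂μ, ∀ᶠ n in atTop, (x ∈ S n ↔ x ∈ T)) :
    Tendsto (fun n => μ.real (S n)) atTop (𝓝 (μ.real T)) := by
  simpa using tendsto_setIntegral_of_ae (integrable_const (1 : ℝ)) hS hT h

theorem sum_setIntegral (hf : Integrable f μ) {ι : Type*} (A : Finset ι) {S : ι → Set X}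
    (hS : ∀ i, MeasurableSet (S i)) :
    ∑ i ∈ A, ∫ x in S i, f x ∂μ = ∫ x, ∑ i ∈ A, (S i).indicator f x ∂μ := by
  rw [integral_finsetSum _ fun i _ => hf.indicator (hS i)]
  exact Finset.sum_congr rfl fun i _ => (integral_indicator (hS i)).symm

end SetIntegral

/-! ### Subdivision into cells and the approximate intermediate value -/

section Cells

variable {α β : Type*} {G : Graph α β}

/-- The points `i / (n + 1)` of the unit interval. -/
noncomputable def gridPoint (n : ℕ) (i : Fin (n + 2)) : I :=
  ⟨(i : ℝ) / (n + 1), by positivity, by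
    rw [div_le_one (by positivity)]
    exact_mod_cast Nat.lt_succ_iff.1 i.2⟩

/-- The segments of length `1 / (n + 1)` into which the edges of the graph are divided. -/
noncomputable def cell (O : EdgeParam G) (n : ℕ) (c : E(G) × Fin (n + 1)) : Set (Point O) :=
  edge O c.1 '' Icc (gridPoint n c.2.castSucc) (gridPoint n c.2.succ)

theorem gridPoint_le (n : ℕ) (i : Fin (n + 1)) :
    gridPoint n i.castSucc ≤ gridPoint n i.succ := by
  refine Subtype.coe_le_coe.1 (div_le_div_of_nonneg_right ?_ (by positivity))
  simp

theorem gridPoint_sub (n : ℕ) (i : Fin (n + 1)) :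
    (gridPoint n i.succ : ℝ) - gridPoint n i.castSucc = 1 / (n + 1) := by
  simp only [gridPoint, Fin.val_succ, Fin.val_castSucc]
  rw [← sub_div]
  simp

theorem exists_mem_grid (n : ℕ) (t : I) :
    ∃ i : Fin (n + 1), t ∈ Icc (gridPoint n i.castSucc) (gridPoint n i.succ) := by
  have hn : (0 : ℝ) < n + 1 := by positivity
  have ht0 : 0 ≤ (t : ℝ) * (n + 1) := mul_nonneg t.2.1 hn.le
  have key : ∀ i : Fin (n + 1), ((i : ℕ) : ℝ) ≤ (t : ℝ) * (n + 1) →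
      (t : ℝ) * (n + 1) ≤ (i : ℕ) + 1 →
      t ∈ Icc (gridPoint n i.castSucc) (gridPoint n i.succ) := by
    intro i h1 h2
    constructor
    · refine Subtype.coe_le_coe.1 ?_
      simp only [gridPoint, Fin.val_castSucc]
      rwa [div_le_iff₀ hn]
    · refine Subtype.coe_le_coe.1 ?_
      simp only [gridPoint, Fin.val_succ]
      rw [le_div_iff₀ hn]
      exact_mod_cast h2
  -- The floor is out of range only at `t = 1`, which belongs to the last cell.
  by_cases h : ⌊(t : ℝ) * (n + 1)⌋₊ < n + 1
  · exact ⟨⟨_, h⟩, key _ (Nat.floor_le ht0) (Nat.lt_floor_add_one _).le⟩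
  · have h1 : ((n + 1 : ℕ) : ℝ) ≤ (t : ℝ) * (n + 1) :=
      (Nat.le_floor_iff ht0).1 (not_lt.1 h)
    have h2 : (t : ℝ) * (n + 1) ≤ n + 1 := mul_le_of_le_one_left hn.le t.2.2
    push_cast at h1
    exact ⟨Fin.last n, key _ (by simp; linarith) (by simpa using h2)⟩

variable {O : EdgeParam G}

theorem isClosed_cell (n : ℕ) (c : E(G) × Fin (n + 1)) : IsClosed (cell O n c) :=
  isClosed_image_edge _ isClosed_Icc

theorem isConnected_cell (n : ℕ) (c : E(G) × Fin (n + 1)) : IsConnected (cell O n c) :=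
  (isConnected_Icc (gridPoint_le n c.2)).image _ (continuous_edge _).continuousOn

theorem measureReal_cell (n : ℕ) (c : E(G) × Fin (n + 1)) :
    (graphMeasure O).real (cell O n c) = 1 / (n + 1) := by
  rw [cell, measureReal_def, graphMeasure_image_Icc, gridPoint_sub, ENNReal.toReal_ofReal]
  positivity

theorem exists_mem_cell (hcov : ∀ x : Point O, ∃ e t, edge O e t = x) (n : ℕ) (x : Point O) :
    ∃ c, x ∈ cell O n c := by
  obtain ⟨e, t, rfl⟩ := hcov x
  obtain ⟨i, hi⟩ := exists_mem_grid n t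
  exact ⟨(e, i), t, hi, rfl⟩

theorem edge_mem_cell {n : ℕ} {c : E(G) × Fin (n + 1)} {e : E(G)} {t : I}
    (ht : (t : ℝ) ∈ Ioo (0 : ℝ) 1) : edge O e t ∈ cell O n c ↔
      e = c.1 ∧ t ∈ Icc (gridPoint n c.2.castSucc) (gridPoint n c.2.succ) := by
  constructor
  · rintro ⟨s, hs, hst⟩
    obtain ⟨h1, h2⟩ := (edge_eq_edge ht).1 hst.symm
    exact ⟨h1, h2 ▸ hs⟩
  · rintro ⟨rfl, h⟩
    exact ⟨t, h, rfl⟩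

theorem gridPoint_mono (n : ℕ) : Monotone (gridPoint n) := fun i j hij =>
  Subtype.coe_le_coe.1 (div_le_div_of_nonneg_right (by exact_mod_cast hij) (by positivity))

/-- Almost every point lies in at most one cell. -/
theorem ae_cell_unique [Finite V(G)] [Finite E(G)] (n : ℕ) :
    ∀ᵐ x ∂(graphMeasure O), ∀ c c', x ∈ cell O n c → x ∈ cell O n c' → c = c' := by
  refine ae_graphMeasure (B := fun _ => range (gridPoint n)) (fun _ => finite_range _) ?_
  rintro e t ht htB ⟨e₁, i⟩ ⟨e₂, j⟩ hc hc'
  obtain ⟨rfl, hi⟩ := (edge_mem_cell ht).1 hc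
  obtain ⟨rfl, hj⟩ := (edge_mem_cell ht).1 hc'
  have key : ∀ i j : Fin (n + 1), t ∈ Icc (gridPoint n i.castSucc) (gridPoint n i.succ) →
      t ∈ Icc (gridPoint n j.castSucc) (gridPoint n j.succ) → ¬ i < j := by
    intro i j hi hj hij
    exact htB ⟨j.castSucc, le_antisymm hj.1 (hi.2.trans (gridPoint_mono n (by
      rw [Fin.le_def]; simpa using hij)))⟩
  rw [show i = j from le_antisymm (not_lt.1 (key _ _ hj hi)) (not_lt.1 (key _ _ hi hj))]

theorem sum_setIntegral_cell [Finite V(G)] [Finite E(G)] (n : ℕ) {f : Point O → ℝ}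
    (hf : Integrable f (graphMeasure O)) (A : Finset (E(G) × Fin (n + 1))) :
    ∑ c ∈ A, ∫ x in cell O n c, f x ∂(graphMeasure O) =
      ∫ x in ⋃ c ∈ A, cell O n c, f x ∂(graphMeasure O) := by
  classical
  have hm : ∀ c, MeasurableSet (cell O n c) := fun c => measurableSet_of_isClosed (isClosed_cell n c)
  rw [sum_setIntegral hf A hm, ← integral_indicator (Finset.measurableSet_biUnion A fun c _ => hm c)]
  refine integral_congr_ae ?_
  filter_upwards [ae_cell_unique n] with x hx
  by_cases h : ∃ c ∈ A, x ∈ cell O n c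
  · obtain ⟨c, hc, hxc⟩ := h
    rw [indicator_of_mem (show x ∈ ⋃ c ∈ A, cell O n c from mem_biUnion hc hxc),
      Finset.sum_eq_single_of_mem c hc fun d _ hdc =>
        indicator_of_notMem (fun hd => hdc (hx _ _ hd hxc)) _, indicator_of_mem hxc]
  · rw [indicator_of_notMem (by simpa using h)]
    exact Finset.sum_eq_zero fun c hc => indicator_of_notMem (fun hxc => h ⟨c, hc, hxc⟩) _

theorem measureReal_biUnion_cell [Finite V(G)] [Finite E(G)] (n : ℕ)
    (A : Finset (E(G) × Fin (n + 1))) :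
    (graphMeasure O).real (⋃ c ∈ A, cell O n c) = A.card / (n + 1) := by
  have := sum_setIntegral_cell n (integrable_const (μ := graphMeasure O) (1 : ℝ)) A
  simp only [setIntegral_const, smul_eq_mul, mul_one, measureReal_cell, Finset.sum_const,
    nsmul_eq_mul] at this
  rw [← this, mul_one_div]

open Classical in
/-- The cells that meet the set `U`. -/
noncomputable def meetingCells [Fintype E(G)] (n : ℕ) (U : Set (Point O)) :
    Finset (E(G) × Fin (n + 1)) :=
  Finset.univ.filter fun c => (cell O n c ∩ U).Nonempty

theorem mem_meetingCells [Fintype E(G)] {n : ℕ} {U : Set (Point O)} {c : E(G) × Fin (n + 1)} :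
    c ∈ meetingCells n U ↔ (cell O n c ∩ U).Nonempty := by
  simp [meetingCells]

/-- The traces of these cells on `U` are closed with connected union `U`, and cells meet wherever
their traces do. -/
theorem cutConnected_meetingCells [Fintype E(G)] (hcov : ∀ x : Point O, ∃ e t, edge O e t = x)
    (n : ℕ) {U : Set (Point O)} (hU : IsClosed U) (hc : IsConnected U) :
    CutConnected (fun c d => (cell O n c ∩ cell O n d).Nonempty) (meetingCells n U) := by
  have hunion : ⋃ c ∈ meetingCells n U, cell O n c ∩ U = U := by
    refine Subset.antisymm (iUnion₂_subset fun _ _ => inter_subset_right) fun x hx => ?_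
    obtain ⟨c, hxc⟩ := exists_mem_cell hcov n x
    exact mem_biUnion (mem_meetingCells.2 ⟨x, hxc, hx⟩) ⟨hxc, hx⟩
  have hne : (meetingCells n U).Nonempty := by
    obtain ⟨x, hx⟩ := hc.nonempty
    obtain ⟨c, hxc⟩ := exists_mem_cell hcov n x
    exact ⟨c, mem_meetingCells.2 ⟨x, hxc, hx⟩⟩
  refine (cutConnected_of_isPreconnected (s := fun c => cell O n c ∩ U) hne
    (fun c _ => (isClosed_cell n c).inter hU) (fun c hc => mem_meetingCells.1 hc)
    (hunion.symm ▸ hc.isPreconnected)).mono fun c _ d _ h => ?_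
  exact h.mono (inter_subset_inter inter_subset_left inter_subset_left)

/-- An interior point of an edge outside the closed set `U` has a neighbourhood in its edge missing
`U`, and it eventually contains every cell through the point. -/
theorem ae_eventually_mem_meetingCells [Finite V(G)] [Fintype E(G)]
    (hcov : ∀ x : Point O, ∃ e t, edge O e t = x) {U : Set (Point O)} (hU : IsClosed U) :
    ∀ᵐ x ∂(graphMeasure O), ∀ᶠ n in atTop,
      (x ∈ ⋃ c ∈ meetingCells n U, cell O n c ↔ x ∈ U) := by
  refine ae_graphMeasure (B := fun _ => ∅) (fun _ => finite_empty) ?_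
  intro e t ht _
  by_cases htU : edge O e t ∈ U
  · refine Eventually.of_forall fun n => iff_of_true ?_ htU
    obtain ⟨c, hxc⟩ := exists_mem_cell hcov n (edge O e t)
    exact mem_biUnion (mem_meetingCells.2 ⟨_, hxc, htU⟩) hxc
  · have hopen : IsOpen (edge O e ⁻¹' U)ᶜ := ((isClosed_iff O U).1 hU e).isOpen_compl
    obtain ⟨δ, hδ, hball⟩ := Metric.isOpen_iff.1 hopen t htU
    filter_upwards [tendsto_one_div_add_atTop_nhds_zero_nat.eventually_lt_const hδ] with n hn
    refine iff_of_false (fun h => ?_) htU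
    simp only [mem_iUnion, exists_prop] at h
    obtain ⟨⟨e', i⟩, hc, htc⟩ := h
    obtain ⟨rfl, hti⟩ := (edge_mem_cell ht).1 htc
    obtain ⟨_, ⟨s, hs, rfl⟩, hsU⟩ := mem_meetingCells.1 hc
    refine hball (show s ∈ Metric.ball t δ from ?_) hsU
    rw [Metric.mem_ball, Subtype.dist_eq, Real.dist_eq]
    refine lt_of_le_of_lt ?_ hn
    rw [← gridPoint_sub n i]
    have h1 : (gridPoint n i.castSucc : ℝ) ≤ t := hti.1
    have h2 : (t : ℝ) ≤ gridPoint n i.succ := hti.2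
    have h3 : (gridPoint n i.castSucc : ℝ) ≤ s := hs.1
    have h4 : (s : ℝ) ≤ gridPoint n i.succ := hs.2
    rw [abs_le]
    constructor <;> linarith

/-- Two connected closed sets of the same measure over which the integrals of `f` have opposite
signs can be replaced by one of almost that measure over which the integral almost vanishes. -/
theorem exists_almost_zero [Finite V(G)] [Finite E(G)] [ConnectedSpace (Point O)]
    (hcov : ∀ x : Point O, ∃ e t, edge O e t = x) {f : Point O → ℝ}
    (hf : Integrable f (graphMeasure O)) {M : ℝ} (hM : ∀ x, |f x| ≤ M) {r : ℝ}
    {U W : Set (Point O)} (hU : U ∈ connectedSets O r) (hW : W ∈ connectedSets O r)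
    (hfU : ∫ x in U, f x ∂(graphMeasure O) ≤ 0) (hfW : 0 ≤ ∫ x in W, f x ∂(graphMeasure O))
    {ε : ℝ} (hε : 0 < ε) : ∃ Z : Set (Point O), IsClosed Z ∧ IsConnected Z ∧
      |(graphMeasure O).real Z - r| ≤ ε ∧ |∫ x in Z, f x ∂(graphMeasure O)| ≤ ε := by
  classical
  cases nonempty_fintype E(G)
  have hm : ∀ n (A : Finset (E(G) × Fin (n + 1))), MeasurableSet (⋃ c ∈ A, cell O n c) :=
    fun n A => Finset.measurableSet_biUnion A fun c _ =>
      measurableSet_of_isClosed (isClosed_cell n c)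
  have happrox : ∀ {T : Set (Point O)}, T ∈ connectedSets O r → ∀ᶠ n : ℕ in atTop,
      |((meetingCells n T).card : ℝ) / (n + 1) - r| < ε / 2 ∧
      |∑ c ∈ meetingCells n T, ∫ x in cell O n c, f x ∂(graphMeasure O) -
        ∫ x in T, f x ∂(graphMeasure O)| < ε / 2 := by
    rintro T ⟨hT, -, hr⟩
    have hae := ae_eventually_mem_meetingCells hcov hT
    have h1 := tendsto_measureReal_of_ae (fun n => hm n _) (measurableSet_of_isClosed hT) hae
    have h2 := tendsto_setIntegral_of_ae hf (fun n => hm n _) (measurableSet_of_isClosed hT) hae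
    simp only [measureReal_biUnion_cell, hr, ← sum_setIntegral_cell _ hf] at h1 h2
    filter_upwards [Metric.tendsto_nhds.1 h1 _ (half_pos hε),
      Metric.tendsto_nhds.1 h2 _ (half_pos hε)] with n hn1 hn2
    exact ⟨hn1, hn2⟩
  have hlim : Tendsto (fun n : ℕ => (1 : ℝ) / ((n : ℝ) + 1)) atTop (𝓝 0) :=
    tendsto_one_div_add_atTop_nhds_zero_nat
  have hlimM : Tendsto (fun n : ℕ => M * (1 / ((n : ℝ) + 1))) atTop (𝓝 0) := by
    simpa using hlim.const_mul M
  obtain ⟨n, ⟨hUr, hUf⟩, ⟨hWr, hWf⟩, hn, hnM⟩ := ((happrox hU).and ((happrox hW).and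
    ((hlim.eventually_lt_const (half_pos hε)).and
      (hlimM.eventually_lt_const (half_pos hε))))).exists
  have hn0 : (0 : ℝ) < n + 1 := by positivity
  have hcU := cutConnected_meetingCells hcov n hU.1 hU.2.1
  have hcW := cutConnected_meetingCells hcov n hW.1 hW.2.1
  have hcuniv : CutConnected (fun c d => (cell O n c ∩ cell O n d).Nonempty) Finset.univ := by
    have := cutConnected_meetingCells hcov n (isClosed_univ (X := Point O)) isConnected_univ
    have heq : meetingCells n (univ : Set (Point O)) = Finset.univ :=
      Finset.eq_univ_of_forall fun c => mem_meetingCells.2 (by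
        rw [inter_univ]; exact (isConnected_cell n c).nonempty)
    rwa [heq] at this
  -- Half of `ε` pays for approximating `U` and `W` by cells. The other half pays for one cell: its
  -- measure `1 / (n + 1)`, because `u` exceeds the larger size by one, and its integral, at most `M
  -- / (n + 1)`.
  obtain ⟨C, hC, hlC, hCu, hCf⟩ := hcuniv.exists_abs_sum_le
    (l := min (meetingCells n U).card (meetingCells n W).card)
    (u := max (meetingCells n U).card (meetingCells n W).card + 1)
    (fun c d h => by rwa [inter_comm])
    (le_min (Finset.card_pos.2 hcU.1) (Finset.card_pos.2 hcW.1)) hcU hcW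
    (min_le_left _ _) (min_le_right _ _) (Nat.lt_succ_of_le (le_max_left _ _))
    (Nat.lt_succ_of_le (le_max_right _ _))
    (fun c => ∫ x in cell O n c, f x ∂(graphMeasure O)) (δ := M * (1 / (n + 1))) (η := ε / 2)
    (half_pos hε).le
    (fun c => by
      rw [← measureReal_cell (O := O) n c]
      exact norm_setIntegral_le_of_norm_le_const (f := f) (C := M) (measure_lt_top _ _)
        fun x _ => hM x)
    (by linarith [(abs_lt.1 hUf).2]) (by linarith [(abs_lt.1 hWf).1])
  refine ⟨⋃ c ∈ C, cell O n c, isClosed_biUnion_finset fun c _ => isClosed_cell n c,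
    hC.isConnected_biUnion fun c _ => isConnected_cell n c, ?_, ?_⟩
  · rw [measureReal_biUnion_cell]
    rw [abs_lt] at hUr hWr
    rw [abs_le]
    constructor
    · rcases min_le_iff.1 hlC with h | h
      · have : ((meetingCells n U).card : ℝ) / (n + 1) ≤ C.card / (n + 1) := by gcongr
        linarith
      · have : ((meetingCells n W).card : ℝ) / (n + 1) ≤ C.card / (n + 1) := by gcongr
        linarith
    · have hCu' : C.card ≤ (meetingCells n U).card + 1 ∨ C.card ≤ (meetingCells n W).card + 1 := by
        omega
      rcases hCu' with h | h
      · have : (C.card : ℝ) / (n + 1) ≤ ((meetingCells n U).card + 1) / (n + 1) := by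
          gcongr; exact_mod_cast h
        rw [add_div] at this
        linarith
      · have : (C.card : ℝ) / (n + 1) ≤ ((meetingCells n W).card + 1) / (n + 1) := by
          gcongr; exact_mod_cast h
        rw [add_div] at this
        linarith
  · rw [← sum_setIntegral_cell n hf]
    linarith

end Cells

/-! ### Sequential compactness of the connected closed sets -/

section Compactness

variable {α β : Type*} {G : Graph α β} {O : EdgeParam G}

/-- Every sequence of connected closed sets has a subsequence which converges almost everywhere to
a connected closed set. -/
theorem exists_subseq_ae_eventually [Finite V(G)] [Finite E(G)]
    (hcov : ∀ x : Point O, ∃ e t, edge O e t = x) {U : ℕ → Set (Point O)}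
    (hU : ∀ n, IsClosed (U n)) (hc : ∀ n, IsConnected (U n)) :
    ∃ (T : Set (Point O)) (φ : ℕ → ℕ), IsClosed T ∧ IsConnected T ∧ StrictMono φ ∧
      ∀ᵐ x ∂(graphMeasure O), ∀ᶠ n in atTop, (x ∈ U (φ n) ↔ x ∈ T) := by
  classical
  cases nonempty_fintype E(G)
  choose a b q hab hq using fun n e => exists_trace_eq_Icc (hU n) (hc n).isPreconnected e
  let J : ℕ → E(G) × Bool → Set (Point O) := fun n p =>
    edge O p.1 '' Icc (a n p.1 p.2) (b n p.1 p.2)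
  -- Parameters of a common point are recorded for every pair of segments that meet; `(0, 0)` is a
  -- dummy for the other pairs.
  have hw : ∀ n (p : (E(G) × Bool) × (E(G) × Bool)), ∃ w : I × I,
      (J n p.1 ∩ J n p.2).Nonempty → w.1 ∈ Icc (a n p.1.1 p.1.2) (b n p.1.1 p.1.2) ∧
        w.2 ∈ Icc (a n p.2.1 p.2.2) (b n p.2.1 p.2.2) ∧ edge O p.1.1 w.1 = edge O p.2.1 w.2 := by
    intro n p
    by_cases h : (J n p.1 ∩ J n p.2).Nonempty
    · obtain ⟨_, ⟨s, hs, rfl⟩, ⟨t, ht, hst⟩⟩ := h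
      exact ⟨(s, t), fun _ => ⟨hs, ht, hst.symm⟩⟩
    · exact ⟨(0, 0), fun h' => absurd h' h⟩
  choose w hw using hw
  have hcut : ∀ n, CutConnected (fun p p' => (J n p ∩ J n p').Nonempty)
      (Finset.univ.filter fun p : E(G) × Bool => q n p.1 p.2 = true) := by
    intro n
    have hunion : ⋃ p ∈ Finset.univ.filter fun p : E(G) × Bool => q n p.1 p.2 = true, J n p =
        U n := by
      ext x
      obtain ⟨e, t, rfl⟩ := hcov x
      simp only [mem_iUnion, Finset.mem_filter, Finset.mem_univ, true_and, exists_prop]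
      constructor
      · rintro ⟨⟨e', i⟩, hqi, s, hs, hst⟩
        rw [← hst]
        exact (hq n e' s).2 ⟨i, hqi, hs⟩
      · intro h
        obtain ⟨i, hqi, ht⟩ := (hq n e t).1 h
        exact ⟨(e, i), hqi, t, ht, rfl⟩
    refine cutConnected_of_isPreconnected ?_ (fun p _ => isClosed_image_edge _ isClosed_Icc)
      (fun p hp => ?_) (hunion.symm ▸ (hc n).isPreconnected)
    · obtain ⟨x, hx⟩ := (hc n).nonempty
      rw [← hunion] at hx
      simp only [mem_iUnion, exists_prop] at hx
      obtain ⟨p, hp, -⟩ := hx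
      exact ⟨p, hp⟩
    · exact (nonempty_Icc.2 (hab n p.1 p.2 (Finset.mem_filter.1 hp).2)).image _
  -- End points, presence flags, the intersection pattern and the common points all range over
  -- compact spaces. The Boolean data become constant along the subsequence.
  obtain ⟨⟨ab, q', g', w'⟩, φ, hφ, hlim⟩ := CompactSpace.tendsto_subseq
    (fun n => ((fun p => (a n p.1 p.2, b n p.1 p.2), fun p => q n p.1 p.2,
      fun p => decide (J n p.1 ∩ J n p.2).Nonempty, w n) :
      (E(G) × Bool → I × I) × (E(G) × Bool → Bool) ×
        ((E(G) × Bool) × (E(G) × Bool) → Bool) × ((E(G) × Bool) × (E(G) × Bool) → I × I)))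
  rw [nhds_prod_eq, nhds_prod_eq, nhds_prod_eq] at hlim
  have hlab := tendsto_pi_nhds.1 (tendsto_fst.comp hlim)
  have hlq := tendsto_pi_nhds.1 ((tendsto_fst.comp tendsto_snd).comp hlim)
  have hlg := tendsto_pi_nhds.1 ((tendsto_fst.comp (tendsto_snd.comp tendsto_snd)).comp hlim)
  have hlw := tendsto_pi_nhds.1 ((tendsto_snd.comp (tendsto_snd.comp tendsto_snd)).comp hlim)
  have hla : ∀ p : E(G) × Bool, Tendsto (fun n => a (φ n) p.1 p.2) atTop (𝓝 (ab p).1) :=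
    fun p => (continuous_fst.tendsto _).comp (hlab p)
  have hlb : ∀ p : E(G) × Bool, Tendsto (fun n => b (φ n) p.1 p.2) atTop (𝓝 (ab p).2) :=
    fun p => (continuous_snd.tendsto _).comp (hlab p)
  have hevq : ∀ᶠ n in atTop, ∀ p : E(G) × Bool, q (φ n) p.1 p.2 = q' p :=
    eventually_all.2 fun p => (hlq p).eventually_mem (mem_nhds_discrete.2 (mem_singleton _))
  have hevg : ∀ᶠ n in atTop, ∀ p, decide (J (φ n) p.1 ∩ J (φ n) p.2).Nonempty = g' p :=
    eventually_all.2 fun p => (hlg p).eventually_mem (mem_nhds_discrete.2 (mem_singleton _))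
  let K : E(G) × Bool → Set (Point O) := fun p => edge O p.1 '' Icc (ab p).1 (ab p).2
  have hle : ∀ p, q' p = true → (ab p).1 ≤ (ab p).2 := fun p hp =>
    le_of_tendsto_of_tendsto (hla p) (hlb p) (hevq.mono fun n hn => hab _ _ _ ((hn p).trans hp))
  have hmeet : ∀ p p', g' (p, p') = true → (K p ∩ K p').Nonempty := by
    intro p p' hg
    have hev : ∀ᶠ n in atTop, (w (φ n) (p, p')).1 ∈ Icc (a (φ n) p.1 p.2) (b (φ n) p.1 p.2) ∧
        (w (φ n) (p, p')).2 ∈ Icc (a (φ n) p'.1 p'.2) (b (φ n) p'.1 p'.2) ∧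
        edge O p.1 (w (φ n) (p, p')).1 = edge O p'.1 (w (φ n) (p, p')).2 :=
      hevg.mono fun n hn => hw _ (p, p') (of_decide_eq_true ((hn (p, p')).trans hg))
    have h1 := (continuous_fst.tendsto _).comp (hlw (p, p'))
    have h2 := (continuous_snd.tendsto _).comp (hlw (p, p'))
    refine ⟨edge O p.1 (w' (p, p')).1, ⟨_, ⟨?_, ?_⟩, rfl⟩, ⟨(w' (p, p')).2, ⟨?_, ?_⟩, ?_⟩⟩
    · exact le_of_tendsto_of_tendsto (hla p) h1 (hev.mono fun n hn => hn.1.1)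
    · exact le_of_tendsto_of_tendsto h1 (hlb p) (hev.mono fun n hn => hn.1.2)
    · exact le_of_tendsto_of_tendsto (hla p') h2 (hev.mono fun n hn => hn.2.1.1)
    · exact le_of_tendsto_of_tendsto h2 (hlb p') (hev.mono fun n hn => hn.2.1.2)
    · exact ((isClosed_setOf_edge_eq p.1 p'.1).mem_of_tendsto (hlw (p, p'))
        (hev.mono fun n hn => hn.2.2)).symm
  set F := Finset.univ.filter fun p : E(G) × Bool => q' p = true with hF
  -- The intersection pattern of a late term holds for the limit segments, since the recorded common
  -- points converge.
  have hcutF : CutConnected (fun p p' => (K p ∩ K p').Nonempty) F := by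
    obtain ⟨n, hnq, hng⟩ := (hevq.and hevg).exists
    have := hcut (φ n)
    simp only [hnq] at this
    exact this.mono fun p _ p' _ h => hmeet p p' ((hng (p, p')).symm.trans (decide_eq_true h))
  refine ⟨⋃ p ∈ F, K p, φ, isClosed_biUnion_finset fun p _ => isClosed_image_edge _ isClosed_Icc,
    hcutF.isConnected_biUnion fun p hp => ?_, hφ, ?_⟩
  · exact (isConnected_Icc (hle p (Finset.mem_filter.1 hp).2)).image _
      (continuous_edge _).continuousOn
  -- Away from the limits of the end points, membership in each segment is eventually constant.
  · refine ae_graphMeasure (B := fun _ => (range fun p => (ab p).1) ∪ range fun p => (ab p).2)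
      (fun _ => (finite_range _).union (finite_range _)) ?_
    intro e t ht htB
    have hIcc : ∀ᶠ n in atTop, ∀ p : E(G) × Bool,
        (t ∈ Icc (a (φ n) p.1 p.2) (b (φ n) p.1 p.2) ↔ t ∈ Icc (ab p).1 (ab p).2) := by
      refine eventually_all.2 fun p => ?_
      have hta : t ≠ (ab p).1 := fun h => htB (.inl ⟨p, h.symm⟩)
      have htb : t ≠ (ab p).2 := fun h => htB (.inr ⟨p, h.symm⟩)
      have h1 : ∀ᶠ n in atTop, (a (φ n) p.1 p.2 ≤ t ↔ (ab p).1 ≤ t) := by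
        rcases lt_or_gt_of_ne hta with h | h
        · filter_upwards [(hla p).eventually_const_lt h] with n hn
          exact iff_of_false hn.not_ge h.not_ge
        · filter_upwards [(hla p).eventually_lt_const h] with n hn
          exact iff_of_true hn.le h.le
      have h2 : ∀ᶠ n in atTop, (t ≤ b (φ n) p.1 p.2 ↔ t ≤ (ab p).2) := by
        rcases lt_or_gt_of_ne htb with h | h
        · filter_upwards [(hlb p).eventually_const_lt h] with n hn
          exact iff_of_true hn.le h.le
        · filter_upwards [(hlb p).eventually_lt_const h] with n hn
          exact iff_of_false hn.not_ge h.not_ge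
      filter_upwards [h1, h2] with n hn1 hn2
      rw [mem_Icc, mem_Icc, hn1, hn2]
    filter_upwards [hIcc, hevq] with n hn hnq
    rw [hq]
    simp only [mem_iUnion, exists_prop, hF, Finset.mem_filter, Finset.mem_univ, true_and]
    constructor
    · rintro ⟨i, hi, hti⟩
      exact ⟨(e, i), (hnq (e, i)).symm.trans hi, t, (hn (e, i)).1 hti, rfl⟩
    · rintro ⟨⟨e', i⟩, hi, s, hs, hst⟩
      obtain ⟨rfl, rfl⟩ := (edge_eq_edge ht).1 hst.symm
      exact ⟨i, (hnq (e, i)).trans hi, (hn (e, i)).2 hs⟩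

end Compactness

/-! ### Proof of the inclusion -/

section Main

variable {α β : Type*} {G : Graph α β} {O : EdgeParam G}

/-- Almost everywhere the indicators of the `U a` add up to `n`, so the integrals over the `U a`
have sum zero and cannot all have the same strict sign. -/
theorem exists_integral_nonpos_nonneg [Finite E(G)] {f : Point O → ℝ}
    (hf : Integrable f (graphMeasure O)) (hf0 : ∫ x, f x ∂(graphMeasure O) = 0) {r : ℝ}
    (hr : r ∈ partitionSet O) : ∃ U ∈ connectedSets O r, ∃ W ∈ connectedSets O r,
      ∫ x in U, f x ∂(graphMeasure O) ≤ 0 ∧ 0 ≤ ∫ x in W, f x ∂(graphMeasure O) := by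
  classical
  obtain ⟨n, k, -, hk, U, hU, hfin⟩ := hr
  have : NeZero k := ⟨hk.ne'⟩
  have hsum : ∑ a, ∫ x in U a, f x ∂(graphMeasure O) = 0 := by
    rw [sum_setIntegral hf _ fun a => measurableSet_of_isClosed (hU a).1]
    have hae : ∀ᵐ x ∂(graphMeasure O), {a | x ∈ U a}.ncard = n :=
      graphMeasure_finite hfin
    rw [integral_congr_ae (g := fun x => (n : ℝ) * f x), integral_const_mul, hf0, mul_zero]
    filter_upwards [hae] with x hx
    rw [← hx, ncard_eq_toFinset_card', ← nsmul_eq_mul, ← Finset.sum_const]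
    simp [indicator_apply, Finset.sum_ite]
  obtain ⟨a, -, ha⟩ := Finset.exists_le_of_sum_le (s := Finset.univ) (f := fun a =>
    ∫ x in U a, f x ∂(graphMeasure O)) (g := fun _ => 0) Finset.univ_nonempty (by simp [hsum])
  obtain ⟨b, -, hb⟩ := Finset.exists_le_of_sum_le (s := Finset.univ) (f := fun _ => (0 : ℝ))
    (g := fun a => ∫ x in U a, f x ∂(graphMeasure O)) Finset.univ_nonempty (by simp [hsum])
  exact ⟨U a, hU a, U b, hU b, ha, hb⟩

/-- Here no point lies on an edge, so the covering by cells is unavailable; but the measure is zero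
and only `r = 0` can occur. -/
theorem closure_partitionSet_subset_of_isEmpty [IsEmpty E(G)] :
    closure (partitionSet O) ⊆ chordSet O := by
  have hμ : graphMeasure O = 0 := by
    simp [graphMeasure]
  have hr0 : ∀ {r U}, U ∈ connectedSets O r → r = 0 := by
    rintro r U ⟨-, -, h⟩
    simpa [hμ] using h.symm
  have hP : partitionSet O ⊆ {0} := by
    rintro r ⟨n, k, -, hk, U, hU, -⟩
    exact hr0 (hU ⟨0, hk⟩)
  intro r hr f _ _
  obtain ⟨r', n, k, -, hk, U, hU, -⟩ := closure_nonempty_iff.1 ⟨r, hr⟩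
  have h := hU ⟨0, hk⟩
  rw [hr0 h] at h
  rw [show r = 0 from closure_minimal hP isClosed_singleton hr]
  exact ⟨_, h, by simp [hμ]⟩

theorem closure_partitionSet_subset_of_nonempty [Finite V(G)] [Finite E(G)] [Nonempty E(G)]
    (hG : IsConnectedGraph G) : closure (partitionSet O) ⊆ chordSet O := by
  have := connectedSpace_point hG O
  have hcov := exists_edge_eq hG O
  intro r hr f hf hf0
  have hint := integrable hcov hf
  obtain ⟨M, hM⟩ := exists_bound hcov hf
  -- One half of the bound on the measure is for replacing `r` by a nearby `r'` in the partition
  -- set, the other for `exists_almost_zero`.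
  have hex : ∀ k : ℕ, ∃ Z : Set (Point O), IsClosed Z ∧ IsConnected Z ∧
      |(graphMeasure O).real Z - r| ≤ 2 * (1 / ((k : ℝ) + 1)) ∧
      |∫ x in Z, f x ∂(graphMeasure O)| ≤ 2 * (1 / ((k : ℝ) + 1)) := by
    intro k
    have hε : (0 : ℝ) < 1 / ((k : ℝ) + 1) := by positivity
    obtain ⟨r', hr', hrr'⟩ := Metric.mem_closure_iff.1 hr _ hε
    obtain ⟨U, hU, W, hW, hfU, hfW⟩ := exists_integral_nonpos_nonneg hint hf0 hr'
    obtain ⟨Z, hZ, hZc, h1, h2⟩ := exists_almost_zero hcov hint hM hU hW hfU hfW hε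
    refine ⟨Z, hZ, hZc, ?_, by linarith⟩
    rw [Real.dist_eq, abs_lt] at hrr'
    rw [abs_le] at h1 ⊢
    constructor <;> linarith
  choose Z hZ hZc hZr hZf using hex
  obtain ⟨T, φ, hT, hTc, hφ, hae⟩ := exists_subseq_ae_eventually hcov hZ hZc
  have hlim : Tendsto (fun k => 2 * (1 / (((φ k : ℕ) : ℝ) + 1))) atTop (𝓝 0) := by
    have := (tendsto_one_div_add_atTop_nhds_zero_nat.const_mul (2 : ℝ)).comp hφ.tendsto_atTop
    rwa [mul_zero] at this
  have hmT := measurableSet_of_isClosed hT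
  have hmZ := fun n => measurableSet_of_isClosed (hZ (φ n))
  refine ⟨T, ⟨hT, hTc, ?_⟩, ?_⟩
  · refine tendsto_nhds_unique (tendsto_measureReal_of_ae hmZ hmT hae)
      (tendsto_iff_dist_tendsto_zero.2 (squeeze_zero (fun _ => dist_nonneg) (fun k => ?_) hlim))
    exact hZr (φ k)
  · refine tendsto_nhds_unique (tendsto_setIntegral_of_ae hint hmZ hmT hae)
      (squeeze_zero_norm (fun k => ?_) hlim)
    exact hZf (φ k)

end Main

end MetricGraph

theorem theorem1 {α β : Type*} (G : Graph α β) (hV : V(G).Finite) (hE : E(G).Finite)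
    (hG : MetricGraph.IsConnectedGraph G) (O : MetricGraph.EdgeParam G) :
    closure (MetricGraph.partitionSet O) ⊆ MetricGraph.chordSet O := by
  have := hV.to_subtype
  have := hE.to_subtype
  cases isEmpty_or_nonempty E(G)
  · exact MetricGraph.closure_partitionSet_subset_of_isEmpty
  · exact MetricGraph.closure_partitionSet_subset_of_nonempty hG
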